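/- Let $T_1$ and $T_2$ be the trees on the vertex set $\{0,1,\dots,15\}$, both rooted at $0$, with edge sets $$E(T_1)=\{01,\,02,\,13,\,14,\,25,\,36,\,47,\,58,\,59,\,\{8,10\},\{9,11\},\{10,12\},\{11,13\},\{13,14\},\{13,15\}\},$$ $$E(T_2)=\{01,\,02,\,13,\,24,\,25,\,36,\,37,\,48,\,59,\,\{8,10\},\{9,11\},\{11,12\},\{11,13\},\{12,14\},\{13,15\}\},$$ where $ab$ abbreviates $\{a,b\}$ (McKay's rooted trees). For rooted trees $\tau$ and $\sigma$ let the coalescence $\tau\cdot\sigma$ be the tree obtained from their disjoint union by identifying the two roots. For a finite simple graph $\Gamma$ with vertex set $S$, let $$G(\Gamma)=\langle s\in S \mid s^2=1\ (s\in S),\ (ss')^2=1\ (\{s,s'\}\in E(\Gamma))\rangle$$ be the right-angled Coxeter group based on $\Gamma$; its geodesic growth series with respect to $S$ is $\sum_{m\ge 0} f(m)\,t^m$, where $f(m)$ is the number of words $w\in S^*$ of length $m$ that are geodesic, i.e. such that no shorter word over $S$ represents the same element of $G(\Gamma)$. Two finite graphs are co-spectral if their adjacency matrices have the same characteristic polynomial.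 Theorem. Let $n\ge 17$. There are rooted trees on $n-15$ vertices, and for every rooted tree $\tau$ on $n-15$ vertices, the graphs $\Gamma_1=\tau\cdot T_1$ and $\Gamma_2=\tau\cdot T_2$ are trees on $n$ vertices such that (1) $\Gamma_1$ and $\Gamma_2$ are not isomorphic, but they are co-spectral and their complements are co-spectral; and (2) the right-angled Coxeter groups $G(\Gamma_1)$ and $G(\Gamma_2)$ have equal geodesic growth series with respect to their standard generating sets. In other words, the two families $\{\tau\cdot T_1\}$ and $\{\tau\cdot T_2\}$ of trees on $n$ vertices, both indexed by the rooted trees $\tau$ on $n-15$ vertices, have these properties for each index $\tau$. -/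

import Mathlib

noncomputable section

namespace GeodesicGrowth

/-- The coalescence of the rooted graphs `(τ, r)` and `(σ, s)`: the disjoint union of `τ` and `σ`
with the roots `r` and `s` identified. The merged root is `Sum.inl r`; the vertices of `σ` other
than `s` are the `Sum.inr w`. -/
def coalescence {V W : Type*} (τ : SimpleGraph V) (r : V) (σ : SimpleGraph W) (s : W) :
    SimpleGraph (V ⊕ {w : W // w ≠ s}) where
  Adj
    | .inl a, .inl b => τ.Adj a b
    | .inl a, .inr w => a = r ∧ σ.Adj s w
    | .inr w, .inl a => a = r ∧ σ.Adj s w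
    | .inr w, .inr w' => σ.Adj w w'
  symm := ⟨by
    rintro (a | a) (b | b) h
    · exact SimpleGraph.Adj.symm h
    · exact h
    · exact h
    · exact SimpleGraph.Adj.symm h⟩
  loopless := ⟨by
    rintro (a | a) h
    · exact τ.irrefl h
    · exact σ.irrefl h⟩

/-- McKay's first tree, on 16 vertices, to be rooted at `0`. -/
def mckayT1 : SimpleGraph (Fin 16) :=
  SimpleGraph.fromEdgeSet
    {s(0, 1), s(0, 2), s(1, 3), s(1, 4), s(2, 5), s(3, 6), s(4, 7), s(5, 8), s(5, 9),
      s(8, 10), s(9, 11), s(10, 12), s(11, 13), s(13, 14), s(13, 15)}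

/-- McKay's second tree, on 16 vertices, to be rooted at `0`. -/
def mckayT2 : SimpleGraph (Fin 16) :=
  SimpleGraph.fromEdgeSet
    {s(0, 1), s(0, 2), s(1, 3), s(2, 4), s(2, 5), s(3, 6), s(3, 7), s(4, 8), s(5, 9),
      s(8, 10), s(9, 11), s(11, 12), s(11, 13), s(12, 14), s(13, 15)}

/-- The member `τ · T₁` of the first family. -/
abbrev familyOne {V : Type*} (τ : SimpleGraph V) (r : V) :
    SimpleGraph (V ⊕ {w : Fin 16 // w ≠ 0}) :=
  coalescence τ r mckayT1 0

/-- The member `τ · T₂` of the second family. -/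
abbrev familyTwo {V : Type*} (τ : SimpleGraph V) (r : V) :
    SimpleGraph (V ⊕ {w : Fin 16 // w ≠ 0}) :=
  coalescence τ r mckayT2 0

open Classical in
/-- Two finite graphs are co-spectral if their adjacency matrices have the same characteristic
polynomial. -/
def Cospectral {V W : Type*} [Fintype V] [Fintype W] (G : SimpleGraph V) (H : SimpleGraph W) :
    Prop :=
  (G.adjMatrix ℤ).charpoly = (H.adjMatrix ℤ).charpoly

open Classical in
/-- The Coxeter matrix of the right-angled Coxeter group based on `G`: the entry is `2` for adjacent
vertices and `0`, which stands for `∞` (no relation), for distinct non-adjacent ones. Its group is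
`⟨V | s² = 1, (s s')² = 1 for s adjacent to s'⟩`. -/
def racgMatrix {V : Type*} (G : SimpleGraph V) : CoxeterMatrix V where
  M := Matrix.of fun s t => if s = t then 1 else if G.Adj s t then 2 else 0
  isSymm := by
    ext s t
    simp [Matrix.transpose_apply, eq_comm, G.adj_comm]
  diagonal s := by simp
  off_diagonal s t h := by
    simp only [Matrix.of_apply, if_neg h]
    split_ifs <;> decide

/-- The right-angled Coxeter group based on `G`. -/
abbrev RACG {V : Type*} (G : SimpleGraph V) : Type _ := (racgMatrix G).Group

/-- The standard generators of the right-angled Coxeter group, indexed by the vertices. -/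
def racgSystem {V : Type*} (G : SimpleGraph V) : CoxeterSystem (racgMatrix G) (RACG G) :=
  (racgMatrix G).toCoxeterSystem

/-- A word over the standard generators is geodesic if its length is the word length of the group
element that it represents. -/
def IsGeodesic {V : Type*} (G : SimpleGraph V) (w : List V) : Prop :=
  (racgSystem G).length ((racgSystem G).wordProd w) = w.length

/-- The number of geodesic words of length `m` over the standard generators. -/
def geodesicGrowth {V : Type*} (G : SimpleGraph V) (m : ℕ) : ℕ :=
  {w : List V | w.length = m ∧ IsGeodesic G w}.ncard

/-- The geodesic growth series with respect to the standard generators. -/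
def geodesicGrowthSeries {V : Type*} (G : SimpleGraph V) : PowerSeries ℤ :=
  PowerSeries.mk fun m => (geodesicGrowth G m : ℤ)

end GeodesicGrowth

end

/-!
Words that are reduced in the sense that no letter can be moved next to an equal one are exactly the
geodesic ones. On a triangle-free graph, the series counting the geodesic words that are shortened
by a given generator therefore solve a linear system with matrix `a² + a b (1 - D) + b² A`, where
`a = 1 + X`, `b = X`, and `D` and `A` are the degree and adjacency matrices. Intertwiners of
these matrices that respect the all-one vector give equal growth series, just as invertible
intertwiners of the adjacency matrices give equal characteristic polynomials of the graphs and of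
their complements. Explicit intertwiners for `T₁` and `T₂` have the basis vector of the root as an
eigenvector, and hence extend by a scalar to every coalescence with a rooted graph. The graphs are
told apart by their forks: `T₂` has a fork away from the root and `T₁` has none.
-/

noncomputable section

namespace GeodesicGrowth

open Matrix

/-! ### Rooted intertwiners -/

section Intertwiners

variable {V W X R : Type*} [CommRing R] [DecidableEq X]

variable (R) in
/-- The matrix of the linear map `R^W → R^X` that sends the basis vector of `w` to the basis vector
of `f w`. -/
def inclusionMatrix (f : W → X) : Matrix X W R :=
  (1 : Matrix X X R).submatrix id f

lemma inclusionMatrix_transpose_mul [Fintype X] (f : W → X) (g : V → X) :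
    (inclusionMatrix R f)ᵀ * inclusionMatrix R g = (1 : Matrix X X R).submatrix f g := by
  rw [inclusionMatrix, inclusionMatrix, transpose_submatrix, transpose_one,
    submatrix_mul _ _ _ id _ Function.bijective_id |>.symm, one_mul]

lemma inclusionMatrix_transpose_mul_self [Fintype X] [DecidableEq W] {f : W → X}
    (hf : f.Injective) : (inclusionMatrix R f)ᵀ * inclusionMatrix R f = 1 := by
  rw [inclusionMatrix_transpose_mul, submatrix_one f hf]

lemma inclusionMatrix_transpose_mulVec [Fintype X] (f : W → X) (v : X → R) :
    (inclusionMatrix R f)ᵀ *ᵥ v = v ∘ f := by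
  ext w
  simp [inclusionMatrix, mulVec, dotProduct, one_apply]

/-- The sum of a matrix on `V` and a matrix on `W`, both transported to `X`. -/
def glueMatrix [Fintype V] [Fintype W] (f : V → X) (g : W → X) (N : Matrix V V R)
    (M : Matrix W W R) : Matrix X X R :=
  inclusionMatrix R f * N * (inclusionMatrix R f)ᵀ +
    inclusionMatrix R g * M * (inclusionMatrix R g)ᵀ

lemma transpose_glueMatrix [Fintype V] [Fintype W] (f : V → X) (g : W → X) (N : Matrix V V R)
    (M : Matrix W W R) :
    (glueMatrix f g N M)ᵀ = glueMatrix f g Nᵀ Mᵀ := by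
  simp [glueMatrix, Matrix.mul_assoc]

variable [Fintype W] [DecidableEq W]

/-- The matrix on `X` that acts as `Q` on the image of `f` and as the scalar `κ` on the quotient.
If all row sums or all column sums of `Q` are `κ`, then the same holds for the extension. -/
def extendMatrix (κ : R) (f : W → X) (Q : Matrix W W R) : Matrix X X R :=
  κ • 1 + inclusionMatrix R f * (Q - κ • 1) * (inclusionMatrix R f)ᵀ

lemma extendMatrix_smul_one (κ : R) (f : W → X) : extendMatrix κ f (κ • 1) = κ • 1 := by
  simp [extendMatrix]

lemma transpose_extendMatrix (κ : R) (f : W → X) (Q : Matrix W W R) :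
    (extendMatrix κ f Q)ᵀ = extendMatrix κ f Qᵀ := by
  simp [extendMatrix, Matrix.mul_assoc]

variable [Fintype X]

lemma extendMatrix_mul_extendMatrix {f : W → X} (hf : f.Injective) (κ μ : R)
    (P Q : Matrix W W R) :
    extendMatrix κ f P * extendMatrix μ f Q = extendMatrix (κ * μ) f (P * Q) := by
  have h (A B : Matrix W W R) : inclusionMatrix R f * A * (inclusionMatrix R f)ᵀ *
      (inclusionMatrix R f * B * (inclusionMatrix R f)ᵀ) =
      inclusionMatrix R f * (A * B) * (inclusionMatrix R f)ᵀ := by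
    simp only [Matrix.mul_assoc]
    rw [← Matrix.mul_assoc _ (inclusionMatrix R f), inclusionMatrix_transpose_mul_self hf,
      Matrix.one_mul]
  simp only [extendMatrix, Matrix.mul_add, Matrix.add_mul, h, Matrix.mul_smul, Matrix.smul_mul,
    Matrix.mul_one, Matrix.one_mul]
  simp only [Matrix.mul_sub, Matrix.sub_mul, Matrix.mul_smul, Matrix.smul_mul, Matrix.mul_one,
    Matrix.one_mul]
  module

lemma det_extendMatrix_ne_zero [IsDomain R] {f : W → X} (hf : f.Injective) {κ : R} (hκ : κ ≠ 0)
    {Q : Matrix W W R} (hQ : Q.det ≠ 0) : (extendMatrix κ f Q).det ≠ 0 := by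
  have h : extendMatrix κ f Q * extendMatrix Q.det f (κ • Q.adjugate) = (κ * Q.det) • 1 := by
    rw [extendMatrix_mul_extendMatrix hf, Matrix.mul_smul, mul_adjugate, smul_smul,
      extendMatrix_smul_one]
  refine left_ne_zero_of_mul (b := (extendMatrix Q.det f (κ • Q.adjugate)).det) ?_
  rw [← det_mul, h, det_smul, det_one, mul_one]
  exact pow_ne_zero _ (mul_ne_zero hκ hQ)

lemma extendMatrix_mulVec_one {κ : R} (f : W → X) {Q : Matrix W W R} (hQ : Q *ᵥ 1 = κ • 1) :
    extendMatrix κ f Q *ᵥ 1 = κ • 1 := by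
  have h1 : (1 : X → R) ∘ f = 1 := rfl
  rw [extendMatrix, add_mulVec, ← mulVec_mulVec, ← mulVec_mulVec, inclusionMatrix_transpose_mulVec,
    h1, sub_mulVec, hQ, smul_mulVec, smul_mulVec, one_mulVec, one_mulVec, sub_self, mulVec_zero,
    add_zero]

lemma one_vecMul_extendMatrix {κ : R} (f : W → X) {Q : Matrix W W R} (hQ : 1 ᵥ* Q = κ • 1) :
    1 ᵥ* extendMatrix κ f Q = κ • 1 := by
  rw [← mulVec_transpose] at hQ ⊢
  rw [transpose_extendMatrix, extendMatrix_mulVec_one f hQ]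

/-- The matrix pair `(P, Q)` intertwines `M₁` and `M₂` and has the properties that let it extend to
matrices obtained by gluing along `s`: the basis vector of `s` is an eigenvector for the columns of
`P` and the rows of `Q`, the all-one vector is one for the rows of `P` and the columns of `Q`, and
all the eigenvalues are `κ`. -/
structure IsRootedIntertwiner (s : W) (κ : R) (M₁ M₂ P Q : Matrix W W R) : Prop where
  mul_eq : P * M₁ = M₂ * Q
  mulVec_single : P *ᵥ Pi.single s 1 = κ • Pi.single s 1
  single_vecMul : Pi.single s 1 ᵥ* Q = κ • Pi.single s 1
  mulVec_one : P *ᵥ 1 = κ • 1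
  one_vecMul : 1 ᵥ* Q = κ • 1

lemma extendMatrix_mul_inclusionMatrix_of_root {f : V → X} {g : W → X} {r : V}
    {s : W} (hfg : ∀ w v, g w = f v ↔ w = s ∧ v = r) {κ : R} {P : Matrix W W R}
    (hP : P *ᵥ Pi.single s 1 = κ • Pi.single s 1) :
    extendMatrix κ g P * inclusionMatrix R f = κ • inclusionMatrix R f := by
  classical
  have hroot : (1 : Matrix X X R).submatrix g f =
      vecMulVec (Pi.single s 1) (Pi.single r 1) := by
    ext w v
    simp only [submatrix_apply, one_apply, hfg, vecMulVec_apply, Pi.single_apply, mul_ite, mul_one,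
      mul_zero, ite_and]
    split_ifs <;> rfl
  rw [extendMatrix, Matrix.add_mul, Matrix.mul_assoc, inclusionMatrix_transpose_mul, hroot,
    Matrix.mul_assoc, mul_vecMulVec, sub_mulVec, hP, smul_mulVec, one_mulVec, sub_self]
  simp

lemma extendMatrix_mul_inclusionMatrix {g : W → X} (hg : g.Injective) (κ : R) (P : Matrix W W R) :
    extendMatrix κ g P * inclusionMatrix R g = inclusionMatrix R g * P := by
  rw [extendMatrix, Matrix.add_mul, Matrix.mul_assoc, inclusionMatrix_transpose_mul_self hg]
  simp [Matrix.mul_sub]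

lemma extendMatrix_mul_glueMatrix [Fintype V] {f : V → X} {g : W → X}
    (hg : g.Injective) {r : V} {s : W} (hfg : ∀ w v, g w = f v ↔ w = s ∧ v = r) {κ : R}
    {P : Matrix W W R} (hP : P *ᵥ Pi.single s 1 = κ • Pi.single s 1) (N : Matrix V V R)
    (M : Matrix W W R) :
    extendMatrix κ g P * glueMatrix f g N M = glueMatrix f g (κ • N) (P * M) := by
  simp only [glueMatrix, Matrix.mul_add, ← Matrix.mul_assoc,
    extendMatrix_mul_inclusionMatrix_of_root hfg hP, extendMatrix_mul_inclusionMatrix hg]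
  simp [Matrix.mul_assoc]

lemma glueMatrix_mul_extendMatrix [Fintype V] {f : V → X} {g : W → X}
    (hg : g.Injective) {r : V} {s : W} (hfg : ∀ w v, g w = f v ↔ w = s ∧ v = r) {κ : R}
    {Q : Matrix W W R} (hQ : Pi.single s 1 ᵥ* Q = κ • Pi.single s 1) (N : Matrix V V R)
    (M : Matrix W W R) :
    glueMatrix f g N M * extendMatrix κ g Q = glueMatrix f g (κ • N) (M * Q) := by
  rw [← mulVec_transpose] at hQ
  have h := extendMatrix_mul_glueMatrix hg hfg hQ Nᵀ Mᵀ
  rw [← transpose_extendMatrix, ← transpose_glueMatrix, ← transpose_mul] at h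
  rw [← transpose_transpose (glueMatrix f g N M * _), h, transpose_glueMatrix]
  simp

/-- The scalar part `c` is not glued, which accounts for the diagonal entry of the common root. -/
theorem IsRootedIntertwiner.extendMatrix_mul_eq [Fintype V] {f : V → X} {g : W → X}
    (hg : g.Injective) {r : V} {s : W} (hfg : ∀ w v, g w = f v ↔ w = s ∧ v = r) {κ c : R}
    {M₁ M₂ P Q : Matrix W W R} (h : IsRootedIntertwiner s κ (c • 1 + M₁) (c • 1 + M₂) P Q)
    (N : Matrix V V R) :
    extendMatrix κ g P * (c • 1 + glueMatrix f g N M₁) =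
      (c • 1 + glueMatrix f g N M₂) * extendMatrix κ g Q := by
  have hdiff : P * M₁ = M₂ * Q + c • (Q - P) := by
    have := h.mul_eq
    simp only [Matrix.mul_add, Matrix.add_mul, Matrix.mul_smul, Matrix.smul_mul, Matrix.mul_one,
      Matrix.one_mul] at this
    linear_combination (norm := module) this
  rw [Matrix.mul_add, Matrix.add_mul, extendMatrix_mul_glueMatrix hg hfg h.mulVec_single,
    glueMatrix_mul_extendMatrix hg hfg h.single_vecMul, hdiff]
  simp only [extendMatrix, glueMatrix, Matrix.mul_add, Matrix.add_mul, Matrix.mul_sub,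
    Matrix.sub_mul, Matrix.mul_smul, Matrix.smul_mul, Matrix.mul_one, Matrix.one_mul]
  module

end Intertwiners

/-! ### Matrices of a coalescence -/

section Coalescence

variable {V W X R : Type*}

open Classical in
/-- The inclusion of the second graph into a coalescence with roots `r` and `s`. -/
def coalescenceInr (r : V) (s : W) : W ↪ V ⊕ {w : W // w ≠ s} where
  toFun w := if h : w = s then .inl r else .inr ⟨w, h⟩
  inj' w w' h := by by_cases hw : w = s <;> by_cases hw' : w' = s <;> simp_all

@[simp] lemma coalescenceInr_root (r : V) (s : W) : coalescenceInr r s s = .inl r :=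
  dif_pos rfl

@[simp] lemma coalescenceInr_coe (r : V) {s : W} (w : {w : W // w ≠ s}) :
    coalescenceInr r s w = .inr w :=
  dif_neg w.2

lemma coalescenceInr_eq_inl_iff {r : V} {s : W} (w : W) (v : V) :
    coalescenceInr r s w = .inl v ↔ w = s ∧ v = r := by
  by_cases hw : w = s
  · simp [hw, eq_comm]
  · simp [coalescenceInr_coe r ⟨w, hw⟩, hw]

variable (τ : SimpleGraph V) (r : V) (σ : SimpleGraph W) (s : W)

lemma coalescence_eq_sup :
    coalescence τ r σ s = τ.map Function.Embedding.inl ⊔ σ.map (coalescenceInr r s) := by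
  ext x y
  rw [SimpleGraph.sup_adj, SimpleGraph.map_adj, SimpleGraph.map_adj]
  constructor
  · rcases x with a | w <;> rcases y with b | w' <;> intro h
    · exact Or.inl ⟨a, b, h, rfl, rfl⟩
    · exact Or.inr ⟨s, w', h.2, by simp [h.1], by simp⟩
    · exact Or.inr ⟨w, s, h.2.symm, by simp, by simp [h.1]⟩
    · exact Or.inr ⟨w, w', h, by simp, by simp⟩
  · rintro (⟨a, b, h, rfl, rfl⟩ | ⟨w, w', h, rfl, rfl⟩)
    · exact h
    · by_cases hw : w = s
      · subst hw
        rw [coalescenceInr_root, coalescenceInr_coe r ⟨w', h.ne'⟩]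
        exact ⟨rfl, h⟩
      · by_cases hw' : w' = s
        · subst hw'
          rw [coalescenceInr_root, coalescenceInr_coe r ⟨w, hw⟩]
          exact ⟨rfl, h.symm⟩
        · rw [coalescenceInr_coe r ⟨w, hw⟩, coalescenceInr_coe r ⟨w', hw'⟩]
          exact h

lemma disjoint_map_inl_map_coalescenceInr :
    Disjoint (τ.map (Function.Embedding.inl : V ↪ V ⊕ {w : W // w ≠ s}))
      (σ.map (coalescenceInr r s)) := by
  rw [SimpleGraph.disjoint_left]
  intro x y hτ hσ
  rw [SimpleGraph.map_adj] at hτ hσ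
  obtain ⟨a, b, -, rfl, rfl⟩ := hτ
  obtain ⟨w, w', hw, h, h'⟩ := hσ
  exact hw.ne (((coalescenceInr_eq_inl_iff w a).1 h).1.trans
    ((coalescenceInr_eq_inl_iff w' b).1 h').1.symm)

section AdjMatrix

variable [CommRing R]

lemma adjMatrix_sup_of_disjoint {G H : SimpleGraph X} [DecidableRel G.Adj] [DecidableRel H.Adj]
    [DecidableRel (G ⊔ H).Adj] (h : Disjoint G H) :
    (G ⊔ H).adjMatrix R = G.adjMatrix R + H.adjMatrix R := by
  ext x y
  have := SimpleGraph.disjoint_left.1 h x y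
  simp only [SimpleGraph.adjMatrix_apply, SimpleGraph.sup_adj, Matrix.add_apply]
  split_ifs <;> simp_all

lemma adjMatrix_map [DecidableEq X] [Fintype W] (G : SimpleGraph W) (f : W ↪ X)
    [DecidableRel G.Adj] [DecidableRel (G.map f).Adj] :
    (G.map f).adjMatrix R = inclusionMatrix R f * G.adjMatrix R * (inclusionMatrix R f)ᵀ := by
  classical
  ext x y
  by_cases hx : ∃ a, x = f a
  · by_cases hy : ∃ b, y = f b
    · obtain ⟨a, rfl⟩ := hx
      obtain ⟨b, rfl⟩ := hy
      have h : (G.map f).adjMatrix R (f a) (f b) = G.adjMatrix R a b := by simp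
      simp [h, inclusionMatrix, mul_apply, one_apply, -SimpleGraph.adjMatrix_apply]
    · push Not at hy
      simp [inclusionMatrix, mul_apply, one_apply, fun b => (hy b).symm]
  · push Not at hx
    simp [inclusionMatrix, mul_apply, one_apply, hx, fun a => (hx a).symm]

lemma inclusionMatrix_mul_diagonal_mul_transpose [DecidableEq W] [DecidableEq X] [Fintype W]
    (f : W → X) (d : W → R) :
    inclusionMatrix R f * diagonal d * (inclusionMatrix R f)ᵀ =
      diagonal (inclusionMatrix R f *ᵥ d) := by
  ext x y
  rw [mul_apply]
  simp only [inclusionMatrix, mul_diagonal, transpose_apply, submatrix_apply, one_apply, id,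
    diagonal_apply, mulVec, dotProduct]
  by_cases hxy : x = y
  · subst hxy
    rw [if_pos rfl]
    exact Finset.sum_congr rfl fun w _ => by split_ifs <;> simp
  · rw [if_neg hxy]
    refine Finset.sum_eq_zero fun w _ => ?_
    grind

lemma degMatrix_eq_diagonal [Fintype V] [DecidableEq V] (G : SimpleGraph V) [DecidableRel G.Adj] :
    G.degMatrix R = diagonal (G.adjMatrix R *ᵥ 1) := by
  ext x y
  simp [SimpleGraph.degMatrix, diagonal_apply, SimpleGraph.adjMatrix_mulVec_apply]

variable [Fintype V] [Fintype W] [DecidableEq V] [DecidableEq W]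
  [DecidableRel τ.Adj] [DecidableRel σ.Adj] [DecidableRel (coalescence τ r σ s).Adj]

lemma adjMatrix_coalescence : (coalescence τ r σ s).adjMatrix R =
    glueMatrix Sum.inl (coalescenceInr r s) (τ.adjMatrix R) (σ.adjMatrix R) := by
  classical
  have h := adjMatrix_sup_of_disjoint (R := R) (disjoint_map_inl_map_coalescenceInr τ r σ s)
  rw [adjMatrix_map, adjMatrix_map] at h
  refine Eq.trans ?_ h
  congr!
  exact coalescence_eq_sup τ r σ s

lemma degMatrix_coalescence : (coalescence τ r σ s).degMatrix R =
    glueMatrix Sum.inl (coalescenceInr r s) (τ.degMatrix R) (σ.degMatrix R) := by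
  simp only [degMatrix_eq_diagonal, adjMatrix_coalescence, glueMatrix, add_mulVec, ← mulVec_mulVec,
    inclusionMatrix_transpose_mulVec, inclusionMatrix_mul_diagonal_mul_transpose, diagonal_add]
  rfl

end AdjMatrix

end Coalescence

/-! ### Cospectrality -/

section Cospectrality

lemma charpoly_eq_of_mul_eq_mul {n R : Type*} [Fintype n] [DecidableEq n] [CommRing R] [IsDomain R]
    {P A B : Matrix n n R} (hP : P.det ≠ 0) (h : P * A = B * P) : A.charpoly = B.charpoly := by
  have hchar : P.map Polynomial.C * A.charmatrix = B.charmatrix * P.map Polynomial.C := by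
    simp only [charmatrix, mul_sub, sub_mul, RingHom.mapMatrix_apply, ← Matrix.map_mul, h]
    congr 1
    exact (scalar_commute _ (Commute.all _) _).symm
  have hdet := congrArg det hchar
  rw [det_mul, det_mul, mul_comm] at hdet
  refine mul_right_cancel₀ ?_ hdet
  rw [← RingHom.mapMatrix_apply, ← RingHom.map_det]
  simpa using hP

variable {V : Type*} [Fintype V] [DecidableEq V] {G₁ G₂ : SimpleGraph V} [DecidableRel G₁.Adj]
  [DecidableRel G₂.Adj] {Q : Matrix V V ℤ}

lemma cospectral_of_mul_eq_mul (hQ : Q.det ≠ 0)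
    (h : Q * G₁.adjMatrix ℤ = G₂.adjMatrix ℤ * Q) : Cospectral G₁ G₂ := by
  unfold Cospectral
  convert charpoly_eq_of_mul_eq_mul hQ h

lemma cospectral_compl_of_mul_eq_mul (hQ : Q.det ≠ 0)
    (h : Q * G₁.adjMatrix ℤ = G₂.adjMatrix ℤ * Q) {k : ℤ} (hrow : Q *ᵥ 1 = k • 1)
    (hcol : 1 ᵥ* Q = k • 1) : Cospectral G₁ᶜ G₂ᶜ := by
  have hcompl (G : SimpleGraph V) [DecidableRel G.Adj] :
      Gᶜ.adjMatrix ℤ = vecMulVec 1 1 - 1 - G.adjMatrix ℤ := by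
    ext x y
    by_cases hxy : x = y <;> by_cases h : G.Adj x y <;>
      simp_all [one_apply]
  refine cospectral_of_mul_eq_mul hQ ?_
  rw [hcompl, hcompl, Matrix.mul_sub, Matrix.sub_mul, h, Matrix.mul_sub, Matrix.sub_mul,
    mul_vecMulVec, vecMulVec_mul, hrow, hcol, Matrix.mul_one, Matrix.one_mul, smul_vecMulVec,
    vecMulVec_smul]

end Cospectrality

theorem IsRootedIntertwiner.cospectral_coalescence {V W : Type*} [Fintype V] [Fintype W]
    [DecidableEq W] {σ₁ σ₂ : SimpleGraph W} [DecidableRel σ₁.Adj] [DecidableRel σ₂.Adj] {s : W}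
    {κ : ℤ} {Q : Matrix W W ℤ}
    (h : IsRootedIntertwiner s κ (σ₁.adjMatrix ℤ) (σ₂.adjMatrix ℤ) Q Q) (hκ : κ ≠ 0)
    (hQ : Q.det ≠ 0) (τ : SimpleGraph V) (r : V) :
    Cospectral (coalescence τ r σ₁ s) (coalescence τ r σ₂ s) ∧
      Cospectral (coalescence τ r σ₁ s)ᶜ (coalescence τ r σ₂ s)ᶜ := by
  classical
  have hdet := det_extendMatrix_ne_zero (coalescenceInr r s).injective hκ hQ
  have hmul : extendMatrix κ (coalescenceInr r s) Q * (coalescence τ r σ₁ s).adjMatrix ℤ =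
      (coalescence τ r σ₂ s).adjMatrix ℤ * extendMatrix κ (coalescenceInr r s) Q := by
    have h0 : IsRootedIntertwiner s κ ((0 : ℤ) • 1 + σ₁.adjMatrix ℤ)
      ((0 : ℤ) • 1 + σ₂.adjMatrix ℤ) Q Q := by simpa using h
    simpa [adjMatrix_coalescence] using h0.extendMatrix_mul_eq (coalescenceInr r s).injective
      coalescenceInr_eq_inl_iff (τ.adjMatrix ℤ)
  exact ⟨cospectral_of_mul_eq_mul hdet hmul, cospectral_compl_of_mul_eq_mul hdet hmul
    (extendMatrix_mulVec_one _ h.mulVec_one) (one_vecMul_extendMatrix _ h.one_vecMul)⟩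

/-! ### Reduced words in right-angled Coxeter groups -/

section Words

variable {V : Type*} (G : SimpleGraph V)

section CoxeterMatrix

variable {G}

lemma racgMatrix_of_adj {s t : V} (h : G.Adj s t) : racgMatrix G s t = 2 :=
  (if_neg h.ne).trans (if_pos h)

lemma racgMatrix_of_not_adj {s t : V} (hst : s ≠ t) (h : ¬G.Adj s t) : racgMatrix G s t = 0 :=
  (if_neg hst).trans (if_neg h)

lemma simple_mul_simple_comm {s t : V} (h : G.Adj s t) :
    (racgSystem G).simple s * (racgSystem G).simple t =
      (racgSystem G).simple t * (racgSystem G).simple s := by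
  have h2 := (racgSystem G).simple_mul_simple_pow s t
  rw [racgMatrix_of_adj h, sq] at h2
  rw [mul_eq_one_iff_eq_inv.1 h2]
  simp

end CoxeterMatrix

/-- A word cancels the letter `s` if some occurrence of `s` in it can be moved to the front by
commutations, so that multiplying by `s` on the left shortens the word. -/
def Cancels (s : V) : List V → Prop
  | [] => False
  | a :: l => a = s ∨ G.Adj s a ∧ Cancels s l

/-- A word is reduced if it has no factor `s u s` with `s` adjacent to all letters of `u`. -/
def Reduced : List V → Prop
  | [] => True
  | a :: l => ¬ Cancels G a l ∧ Reduced l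

/-- The pairs of non-adjacent, possibly equal vertices. -/
abbrev NonEdge : Type _ := {p : Sym2 V // p ∉ G.edgeSet}

/-- The families of words indexed by the non-edges. The group acts on them, and a reduced word sends
the family of empty words to its projections onto the non-edges. -/
abbrev PairWords : Type _ := NonEdge G → List V

open Classical in
/-- The length of the longest prefix that is a power of the letter `s`. -/
def headRun (s : V) (l : List V) : ℕ :=
  (l.takeWhile (· = s)).length

variable {G} in
/-- The largest power of `s` that is a common prefix of the words indexed by pairs containing
`s`. -/
def commonRun (s : V) (f : PairWords G) : ℕ :=
  ⨅ p : {p : NonEdge G // s ∈ p.1}, headRun s (f p.1)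

variable {G} in
open Classical in
/-- Left multiplication by `s`: remove a common leading `s` or add one. Deciding by the parity of
the common run makes this an involution on arbitrary families, not just on projections of words. -/
def toggle (s : V) (f : PairWords G) : PairWords G := fun p =>
  if s ∈ p.1 then (if Odd (commonRun s f) then (f p).tail else s :: f p) else f p

lemma headRun_cons_self (s : V) (l : List V) : headRun s (s :: l) = headRun s l + 1 := by
  simp [headRun]

lemma eq_cons_tail_of_headRun_pos {s : V} {l : List V} (h : 0 < headRun s l) : l = s :: l.tail := by
  cases l with
  | nil => simp [headRun] at h
  | cons a l =>
    by_cases ha : a = s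
    · simp [ha]
    · simp [headRun, ha] at h

instance nonempty_nonEdge_mem (s : V) : Nonempty {p : NonEdge G // s ∈ p.1} :=
  ⟨⟨⟨s(s, s), by simp⟩, by simp⟩⟩

variable {G}

lemma commonRun_le {s : V} (f : PairWords G) (p : NonEdge G) (hp : s ∈ p.1) :
    commonRun s f ≤ headRun s (f p) :=
  ciInf_le' (fun p : {p : NonEdge G // s ∈ p.1} => headRun s (f p.1)) ⟨p, hp⟩

lemma commonRun_eq_succ {s : V} {f g : PairWords G} (h : ∀ p, s ∈ p.1 → g p = s :: f p) :
    commonRun s g = commonRun s f + 1 := by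
  apply le_antisymm
  · obtain ⟨⟨p, hp⟩, hf⟩ := ciInf_mem fun p : {p : NonEdge G // s ∈ p.1} => headRun s (f p.1)
    have h1 := commonRun_le g p hp
    rw [h p hp, headRun_cons_self] at h1
    exact h1.trans (Nat.succ_le_succ hf.le)
  · refine le_ciInf fun p => ?_
    rw [h p.1 p.2, headRun_cons_self]
    exact Nat.succ_le_succ (commonRun_le f p.1 p.2)

lemma commonRun_congr {s : V} {f g : PairWords G} (h : ∀ p, s ∈ p.1 → g p = f p) :
    commonRun s g = commonRun s f :=
  iInf_congr fun p => by rw [h p.1 p.2]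

lemma cons_toggle_of_odd {s : V} {f : PairWords G} {p : NonEdge G} (hp : s ∈ p.1)
    (h : Odd (commonRun s f)) : s :: toggle s f p = f p := by
  rw [toggle, if_pos hp, if_pos h]
  exact (eq_cons_tail_of_headRun_pos (h.pos.trans_le (commonRun_le f p hp))).symm

lemma toggle_of_not_odd {s : V} {f : PairWords G} {p : NonEdge G} (hp : s ∈ p.1)
    (h : ¬ Odd (commonRun s f)) : toggle s f p = s :: f p := by
  rw [toggle, if_pos hp, if_neg h]

lemma toggle_of_notMem {s : V} {f : PairWords G} {p : NonEdge G} (hp : s ∉ p.1) :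
    toggle s f p = f p := by
  rw [toggle, if_neg hp]

lemma odd_commonRun_toggle_iff (s : V) (f : PairWords G) :
    Odd (commonRun s (toggle s f)) ↔ ¬ Odd (commonRun s f) := by
  by_cases h : Odd (commonRun s f)
  · have h1 := commonRun_eq_succ fun p hp => (cons_toggle_of_odd (p := p) hp h).symm
    grind
  · have h1 := commonRun_eq_succ fun p hp => toggle_of_not_odd (p := p) hp h
    grind

lemma toggle_toggle (s : V) (f : PairWords G) : toggle s (toggle s f) = f := by
  funext p
  by_cases hp : s ∈ p.1
  · by_cases h : Odd (commonRun s f)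
    · rw [toggle_of_not_odd hp (by rwa [odd_commonRun_toggle_iff, not_not]),
        cons_toggle_of_odd hp h]
    · have h1 := cons_toggle_of_odd hp ((odd_commonRun_toggle_iff s f).2 h)
      rw [toggle_of_not_odd hp h] at h1
      exact (List.cons.inj h1).2
  · rw [toggle_of_notMem hp, toggle_of_notMem hp]

lemma notMem_nonEdge_of_adj {s t : V} (hst : G.Adj s t) {p : NonEdge G} (hp : s ∈ p.1) :
    t ∉ p.1 := by
  intro ht
  exact p.2 ((Sym2.mem_and_mem_iff hst.ne).1 ⟨hp, ht⟩ ▸ hst)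

lemma toggle_comm_apply_of_mem {s t : V} (hst : G.Adj s t) (f : PairWords G) {p : NonEdge G}
    (hp : s ∈ p.1) : toggle s (toggle t f) p = toggle t (toggle s f) p := by
  have hrun : commonRun s (toggle t f) = commonRun s f :=
    commonRun_congr fun p hp => toggle_of_notMem (notMem_nonEdge_of_adj hst hp)
  have ht := notMem_nonEdge_of_adj hst hp
  rw [toggle_of_notMem (f := toggle s f) ht]
  simp only [toggle.eq_1 s, hrun, toggle_of_notMem ht]

lemma toggle_comm {s t : V} (hst : G.Adj s t) (f : PairWords G) :
    toggle s (toggle t f) = toggle t (toggle s f) := by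
  funext p
  by_cases hs : s ∈ p.1
  · exact toggle_comm_apply_of_mem hst f hs
  · by_cases ht : t ∈ p.1
    · exact (toggle_comm_apply_of_mem hst.symm f ht).symm
    · simp only [toggle_of_notMem hs, toggle_of_notMem ht]

variable (G)

/-- `toggle` as a permutation. -/
def togglePerm (s : V) : Equiv.Perm (PairWords G) :=
  Function.Involutive.toPerm (toggle s) (toggle_toggle s)

lemma togglePerm_mul_self (s : V) : togglePerm G s * togglePerm G s = 1 :=
  Equiv.ext fun f => toggle_toggle s f

lemma isLiftable_togglePerm : (racgMatrix G).IsLiftable (togglePerm G) := by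
  intro s t
  by_cases hst : s = t
  · subst hst
    rw [togglePerm_mul_self, one_pow]
  · by_cases h : G.Adj s t
    · have hcomm : Commute (togglePerm G s) (togglePerm G t) :=
        Equiv.ext fun f => toggle_comm h f
      rw [racgMatrix_of_adj h, hcomm.mul_pow, sq, sq, togglePerm_mul_self, togglePerm_mul_self,
        one_mul]
    · rw [racgMatrix_of_not_adj hst h, pow_zero]

/-- The action of the right-angled Coxeter group on the families of words. -/
def pairAction : RACG G →* Equiv.Perm (PairWords G) :=
  (racgSystem G).lift ⟨togglePerm G, isLiftable_togglePerm G⟩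

lemma pairAction_wordProd_cons (s : V) (l : List V) (f : PairWords G) :
    pairAction G ((racgSystem G).wordProd (s :: l)) f =
      toggle s (pairAction G ((racgSystem G).wordProd l) f) := by
  have hs : pairAction G ((racgSystem G).simple s) = togglePerm G s :=
    (racgSystem G).lift_apply_simple (isLiftable_togglePerm G) s
  rw [CoxeterSystem.wordProd_cons, map_mul, hs]
  rfl

open Classical in
lemma length_pairAction_diag_le_count (l : List V) (s : V) :
    (pairAction G ((racgSystem G).wordProd l) (fun _ => []) ⟨s(s, s), by simp⟩).length ≤
      l.count s := by
  induction l with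
  | nil => simp
  | cons a l ih =>
    rw [pairAction_wordProd_cons]
    by_cases ha : a = s
    · subst ha
      rw [toggle, List.count_cons_self, if_pos (by simp)]
      split_ifs
      · rw [List.length_tail]; omega
      · simpa using ih
    · rw [toggle_of_notMem (by simpa using ha), List.count_cons_of_ne ha]
      exact ih

variable {G}

open Classical in
lemma exists_headRun_filter_eq_zero {s : V} {l : List V} (h : ¬ Cancels G s l) :
    ∃ p : NonEdge G, s ∈ p.1 ∧ headRun s (l.filter (· ∈ p.1)) = 0 := by
  induction l with
  | nil => exact ⟨⟨s(s, s), by simp⟩, by simp, by simp [headRun]⟩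
  | cons a l ih =>
    simp only [Cancels, not_or, not_and] at h
    by_cases ha : G.Adj s a
    · obtain ⟨p, hp, h0⟩ := ih (h.2 ha)
      refine ⟨p, hp, ?_⟩
      rwa [List.filter_cons_of_neg (by simpa using notMem_nonEdge_of_adj ha hp)]
    · refine ⟨⟨s(s, a), by simpa using ha⟩, by simp, ?_⟩
      rw [List.filter_cons_of_pos (by simp)]
      simp [headRun, h.1]

open Classical in
lemma pairAction_wordProd_of_reduced {l : List V} (h : Reduced G l) :
    pairAction G ((racgSystem G).wordProd l) (fun _ => []) = fun p => l.filter (· ∈ p.1) := by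
  induction l with
  | nil => simp
  | cons s l ih =>
    rw [pairAction_wordProd_cons, ih h.2]
    have hrun : commonRun s (fun p : NonEdge G => l.filter (· ∈ p.1)) = 0 := by
      obtain ⟨p, hp, h0⟩ := exists_headRun_filter_eq_zero h.1
      exact Nat.le_zero.1 (h0 ▸ commonRun_le (fun p : NonEdge G => l.filter (· ∈ p.1)) p hp)
    funext p
    by_cases hp : s ∈ p.1
    · rw [toggle_of_not_odd hp (by simp [hrun]), List.filter_cons_of_pos (by simpa using hp)]
    · rw [toggle_of_notMem hp, List.filter_cons_of_neg (by simpa using hp)]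

lemma isGeodesic_of_reduced {l : List V} (h : Reduced G l) : IsGeodesic G l := by
  classical
  refine le_antisymm ((racgSystem G).length_wordProd_le l) ?_
  obtain ⟨l', hred, he⟩ := (racgSystem G).exists_isReduced ((racgSystem G).wordProd l)
  rw [he, hred.eq]
  -- Every word for the same element contains each letter at least as often as the reduced word.
  refine (List.subperm_ext_iff.2 fun s _ => ?_).length_le
  have hcount := length_pairAction_diag_le_count G l' s
  rw [← he, pairAction_wordProd_of_reduced h] at hcount
  simpa [List.count, List.countP_eq_length_filter, beq_eq_decide] using hcount

lemma exists_shorter_of_cancels {s : V} {l : List V} (h : Cancels G s l) :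
    ∃ l' : List V, l'.length < l.length ∧
      (racgSystem G).wordProd (s :: l) = (racgSystem G).wordProd l' := by
  induction l with
  | nil => exact h.elim
  | cons a l ih =>
    rcases h with rfl | ⟨ha, h⟩
    · exact ⟨l, by simp, by simp [CoxeterSystem.wordProd_cons]⟩
    · obtain ⟨l', hl, he⟩ := ih h
      refine ⟨a :: l', by simpa using hl, ?_⟩
      simp only [CoxeterSystem.wordProd_cons] at he ⊢
      rw [← mul_assoc, simple_mul_simple_comm ha, mul_assoc, he]

lemma isGeodesic_iff_reduced {l : List V} : IsGeodesic G l ↔ Reduced G l := by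
  refine ⟨fun h => ?_, isGeodesic_of_reduced⟩
  induction l with
  | nil => trivial
  | cons s l ih =>
    refine ⟨fun hc => ?_, ih (CoxeterSystem.IsReduced.drop (cs := racgSystem G) h 1)⟩
    obtain ⟨l', hl, he⟩ := exists_shorter_of_cancels hc
    have h1 := (racgSystem G).length_wordProd_le l'
    rw [← he, h] at h1
    exact absurd h1 (by simp only [List.length_cons]; omega)

end Words

/-! ### The geodesic growth series of a triangle-free graph -/

section Growth

open PowerSeries

variable {V : Type*} (G : SimpleGraph V)

/-- The generating series of the reduced words with the property `φ`, by length. -/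
def reducedSeries (φ : List V → Prop) : ℤ⟦X⟧ :=
  mk fun m => ({l : List V | l.length = m ∧ Reduced G l ∧ φ l}.ncard : ℤ)

/-- The generating series of the geodesic words whose product is shortened by `v`. -/
def cancelSeries (v : V) : ℤ⟦X⟧ :=
  reducedSeries G (Cancels G v)

/-- The generating series of the geodesic words whose product is shortened by `u` and by `v`. -/
def cancelPairSeries (u v : V) : ℤ⟦X⟧ :=
  reducedSeries G fun l => Cancels G u l ∧ Cancels G v l

lemma geodesicGrowthSeries_eq_reducedSeries :
    geodesicGrowthSeries G = reducedSeries G fun _ => True := by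
  simp only [geodesicGrowthSeries, geodesicGrowth, reducedSeries, isGeodesic_iff_reduced, and_true]

lemma reducedSeries_false : (reducedSeries G fun _ => False) = 0 := by
  ext m
  simp [reducedSeries]

lemma cancelPairSeries_comm (u v : V) : cancelPairSeries G u v = cancelPairSeries G v u := by
  simp only [cancelPairSeries, and_comm]

section Finite

variable [Finite V]

lemma finite_words_of_length (m : ℕ) (φ : List V → Prop) :
    {l : List V | l.length = m ∧ φ l}.Finite :=
  (List.finite_length_eq V m).subset fun _ h => h.1

lemma reducedSeries_not_and (φ ψ : List V → Prop) :
    reducedSeries G (fun l => ¬ φ l ∧ ψ l) =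
      reducedSeries G ψ - reducedSeries G fun l => φ l ∧ ψ l := by
  ext m
  have h := Set.ncard_inter_add_ncard_sdiff_eq_ncard
    {l : List V | l.length = m ∧ Reduced G l ∧ ψ l} {l | φ l} (finite_words_of_length m _)
  have h1 : {l : List V | l.length = m ∧ Reduced G l ∧ ψ l} ∩ {l | φ l} =
      {l | l.length = m ∧ Reduced G l ∧ φ l ∧ ψ l} := by
    ext l; simp only [Set.mem_inter_iff, Set.mem_ofPred_eq]; tauto
  have h2 : {l : List V | l.length = m ∧ Reduced G l ∧ ψ l} \ {l | φ l} =
      {l | l.length = m ∧ Reduced G l ∧ ¬ φ l ∧ ψ l} := by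
    ext l; simp only [Set.mem_sdiff, Set.mem_ofPred_eq]; tauto
  rw [h1, h2] at h
  simp only [reducedSeries, coeff_mk, map_sub, ← h]
  push_cast
  ring

lemma reducedSeries_not (φ : List V → Prop) :
    (reducedSeries G fun l => ¬ φ l) = geodesicGrowthSeries G - reducedSeries G φ := by
  simpa [geodesicGrowthSeries_eq_reducedSeries] using reducedSeries_not_and G φ fun _ => True

end Finite

section FirstLetter

variable [Fintype V]

lemma ncard_reduced_succ (m : ℕ) (φ : List V → Prop) :
    {l : List V | l.length = m + 1 ∧ Reduced G l ∧ φ l}.ncard =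
      ∑ a, {l : List V | l.length = m ∧ Reduced G l ∧ ¬ Cancels G a l ∧ φ (a :: l)}.ncard := by
  have (a : V) : Finite {l : List V | l.length = m ∧ Reduced G l ∧ ¬ Cancels G a l ∧ φ (a :: l)} :=
    (finite_words_of_length m _).to_subtype
  simp only [← Nat.card_coe_set_eq]
  rw [← Nat.card_sigma]
  refine Nat.card_congr ⟨fun x => match x with
      | ⟨[], h⟩ => absurd h.1 (by simp)
      | ⟨a :: l, h⟩ => ⟨a, l, by simpa using h.1, h.2.1.2, h.2.1.1, h.2.2⟩,
    fun x => ⟨x.1 :: x.2.1, by simpa using x.2.2.1, ⟨x.2.2.2.2.1, x.2.2.2.1⟩, x.2.2.2.2.2⟩, ?_, ?_⟩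
  · rintro ⟨_ | ⟨a, l⟩, h⟩
    · exact absurd h.1 (by simp)
    · rfl
  · rintro ⟨a, l, h⟩
    rfl

open Classical in
lemma reducedSeries_eq_add_X_mul_sum (φ : List V → Prop) :
    reducedSeries G φ = (if φ [] then 1 else 0) +
      X * ∑ a, reducedSeries G fun l => ¬ Cancels G a l ∧ φ (a :: l) := by
  ext m
  cases m with
  | zero =>
    have h : {l : List V | l.length = 0 ∧ Reduced G l ∧ φ l} = if φ [] then {[]} else ∅ := by
      ext (_ | ⟨a, l⟩) <;> split_ifs <;> simp_all [Reduced]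
    simp only [reducedSeries, coeff_mk, h]
    split_ifs <;> simp
  | succ m =>
    have h : coeff (m + 1) (if φ [] then (1 : ℤ⟦X⟧) else 0) = 0 := by
      split_ifs <;> simp [coeff_one]
    rw [map_add, h, zero_add, coeff_succ_X_mul, map_sum]
    simp [reducedSeries, ncard_reduced_succ]

lemma geodesicGrowthSeries_eq_one_add_X_mul : geodesicGrowthSeries G =
    1 + X * ((Fintype.card V : ℤ⟦X⟧) * geodesicGrowthSeries G - ∑ v, cancelSeries G v) := by
  conv_lhs => rw [geodesicGrowthSeries_eq_reducedSeries, reducedSeries_eq_add_X_mul_sum]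
  simp [reducedSeries_not, cancelSeries]

end FirstLetter

variable {G} in
/-- A first letter other than `u` and `v` that is shortened by both would complete a triangle. -/
lemma cancelPairSeries_eq_X_mul [Finite V] (htri : G.CliqueFree 3) {u v : V} (huv : G.Adj u v) :
    cancelPairSeries G u v =
      X * (cancelSeries G u + cancelSeries G v - 2 * cancelPairSeries G u v) := by
  classical
  have := Fintype.ofFinite V
  have hletter (a : V) : (reducedSeries G fun l =>
        ¬ Cancels G a l ∧ Cancels G u (a :: l) ∧ Cancels G v (a :: l)) =
      (if a = u then cancelSeries G v - cancelPairSeries G u v else 0) +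
      if a = v then cancelSeries G u - cancelPairSeries G u v else 0 := by
    by_cases hau : a = u
    · subst hau
      simp [Cancels, huv.ne, huv.symm, reducedSeries_not_and, cancelSeries, cancelPairSeries]
    · by_cases hav : a = v
      · subst hav
        rw [cancelPairSeries_comm G u a]
        simp [Cancels, huv.ne', huv, reducedSeries_not_and, cancelSeries, cancelPairSeries]
      · have hnot (l : List V) : ¬ (¬ Cancels G a l ∧ Cancels G u (a :: l) ∧
            Cancels G v (a :: l)) := by
          simp only [Cancels, hau, hav, false_or]
          rintro ⟨-, hu, hv⟩
          exact htri {u, v, a} (SimpleGraph.is3Clique_triple_iff.2 ⟨huv, hu.1, hv.1⟩)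
        simp only [hnot, hau, hav, if_false, add_zero, reducedSeries_false]
  conv_lhs => rw [cancelPairSeries, reducedSeries_eq_add_X_mul_sum, if_neg (by simp [Cancels])]
  simp only [hletter, Finset.sum_add_distrib, Finset.sum_ite_eq', Finset.mem_univ, if_true,
    zero_add]
  ring

section Neighbors

variable [Fintype V] [DecidableRel G.Adj]

lemma cancelSeries_eq_X_mul (v : V) : cancelSeries G v =
    X * (geodesicGrowthSeries G - cancelSeries G v +
      ∑ a ∈ G.neighborFinset v, (cancelSeries G v - cancelPairSeries G v a)) := by
  classical
  have hletter (a : V) : (reducedSeries G fun l => ¬ Cancels G a l ∧ Cancels G v (a :: l)) =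
      (if a = v then geodesicGrowthSeries G - cancelSeries G v else 0) +
      if G.Adj v a then cancelSeries G v - cancelPairSeries G v a else 0 := by
    by_cases hav : a = v
    · subst hav
      simp [Cancels, reducedSeries_not, cancelSeries]
    · by_cases hadj : G.Adj v a
      · rw [cancelPairSeries_comm G v a]
        simp [Cancels, hav, hadj, reducedSeries_not_and, cancelSeries, cancelPairSeries]
      · simp [Cancels, hav, hadj, reducedSeries_false]
  conv_lhs => rw [cancelSeries, reducedSeries_eq_add_X_mul_sum, if_neg (by simp [Cancels])]
  simp only [hletter, Finset.sum_add_distrib, Finset.sum_ite_eq', Finset.mem_univ, if_true,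
    zero_add, ← Finset.sum_filter, G.neighborFinset_eq_filter]

variable [DecidableEq V]

/-- The part of `growthPencil` that is additive under coalescence. -/
def growthPencilPart : Matrix V V ℤ⟦X⟧ :=
  (X ^ 2 : ℤ⟦X⟧) • G.adjMatrix ℤ⟦X⟧ - (X * (1 + X) : ℤ⟦X⟧) • G.degMatrix ℤ⟦X⟧

/-- The matrix of the linear system satisfied by the series `cancelSeries G v`. -/
def growthPencil : Matrix V V ℤ⟦X⟧ :=
  ((1 + X) * (1 + 2 * X) : ℤ⟦X⟧) • (1 : Matrix V V ℤ⟦X⟧) + growthPencilPart G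

lemma transpose_growthPencil : (growthPencil G)ᵀ = growthPencil G := by
  simp [growthPencil, growthPencilPart, SimpleGraph.degMatrix]

variable {G} in
lemma growthPencil_mulVec_cancelSeries (htri : G.CliqueFree 3) :
    growthPencil G *ᵥ cancelSeries G = (X * (1 + 2 * X) * geodesicGrowthSeries G) • 1 := by
  ext1 v
  have hv := cancelSeries_eq_X_mul G v
  have hpair : ∑ a ∈ G.neighborFinset v, cancelPairSeries G v a =
      X * ((G.degree v : ℤ⟦X⟧) * cancelSeries G v + ∑ a ∈ G.neighborFinset v, cancelSeries G a -
        2 * ∑ a ∈ G.neighborFinset v, cancelPairSeries G v a) := by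
    conv_lhs => rw [Finset.sum_congr rfl fun a ha =>
      cancelPairSeries_eq_X_mul htri ((G.mem_neighborFinset v a).1 ha)]
    simp [← Finset.mul_sum, Finset.sum_add_distrib]
  simp only [Finset.sum_sub_distrib, Finset.sum_const, SimpleGraph.card_neighborFinset_eq_degree,
    nsmul_eq_mul] at hv
  simp only [growthPencil, growthPencilPart, add_mulVec, sub_mulVec, smul_mulVec, one_mulVec,
    SimpleGraph.degMatrix, mulVec_diagonal, SimpleGraph.adjMatrix_mulVec_apply, Pi.add_apply,
    Pi.sub_apply, Pi.smul_apply, Pi.one_apply, smul_eq_mul]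
  linear_combination (1 + 2 * X) * hv - X * hpair

end Neighbors

/-- Since the right-hand side of the linear system for `cancelSeries` is a multiple of `1`, an
intertwiner that preserves `1` up to a scalar recovers the sum of its solutions. -/
theorem geodesicGrowthSeries_eq_of_intertwiner [Fintype V] [DecidableEq V]
    {G₁ G₂ : SimpleGraph V} [DecidableRel G₁.Adj] [DecidableRel G₂.Adj] (h₁ : G₁.CliqueFree 3)
    (h₂ : G₂.CliqueFree 3) {κ : ℤ⟦X⟧} (hκ : κ ≠ 0) {P Q : Matrix V V ℤ⟦X⟧}
    (hmul : P * growthPencil G₁ = growthPencil G₂ * Q) (hP : P *ᵥ 1 = κ • 1)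
    (hQ : 1 ᵥ* Q = κ • 1) : geodesicGrowthSeries G₁ = geodesicGrowthSeries G₂ := by
  set F₁ := geodesicGrowthSeries G₁
  set F₂ := geodesicGrowthSeries G₂
  have hsymm : cancelSeries G₂ ᵥ* growthPencil G₂ = (X * (1 + 2 * X) * F₂) • 1 := by
    rw [← mulVec_transpose, transpose_growthPencil, growthPencil_mulVec_cancelSeries h₂]
  have hsum : F₁ * ∑ v, cancelSeries G₂ v = F₂ * ∑ v, cancelSeries G₁ v := by
    have h := congrArg (fun M => cancelSeries G₂ ⬝ᵥ M *ᵥ cancelSeries G₁) hmul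
    simp only [← mulVec_mulVec, growthPencil_mulVec_cancelSeries h₁, mulVec_smul, hP] at h
    rw [dotProduct_mulVec, hsymm, smul_dotProduct, dotProduct_mulVec, hQ] at h
    simp only [dotProduct_smul, smul_dotProduct, dotProduct_one, one_dotProduct, smul_eq_mul] at h
    have hX : κ * (X * (1 + 2 * X)) ≠ (0 : ℤ⟦X⟧) := by
      refine mul_ne_zero hκ (mul_ne_zero X_ne_zero fun h0 => ?_)
      simpa using congrArg (constantCoeff (R := ℤ)) h0
    refine mul_left_cancel₀ hX ?_
    linear_combination h
  have e₁ := geodesicGrowthSeries_eq_one_add_X_mul G₁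
  have e₂ := geodesicGrowthSeries_eq_one_add_X_mul G₂
  linear_combination F₂ * e₁ - F₁ * e₂ + X * hsum

end Growth

section CoalescenceGrowth

open PowerSeries

variable {V W : Type*}

lemma cliqueFree_three_coalescence {τ : SimpleGraph V} {σ : SimpleGraph W} (hτ : τ.CliqueFree 3)
    (hσ : σ.CliqueFree 3) (r : V) (s : W) : (coalescence τ r σ s).CliqueFree 3 := by
  classical
  intro t ht
  obtain ⟨x, y, z, hxy, hxz, hyz, -⟩ := SimpleGraph.is3Clique_iff.1 ht
  have hτ' {a b c : V} (hab : τ.Adj a b) (hac : τ.Adj a c) (hbc : τ.Adj b c) : False :=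
    hτ {a, b, c} (SimpleGraph.is3Clique_triple_iff.2 ⟨hab, hac, hbc⟩)
  have hσ' {a b c : W} (hab : σ.Adj a b) (hac : σ.Adj a c) (hbc : σ.Adj b c) : False :=
    hσ {a, b, c} (SimpleGraph.is3Clique_triple_iff.2 ⟨hab, hac, hbc⟩)
  rcases x with a | u <;> rcases y with b | v <;> rcases z with c | w
  · exact hτ' hxy hxz hyz
  · exact hxy.ne (by rw [hxz.1, hyz.1])
  · exact hxz.ne (by rw [hxy.1, hyz.1])
  · exact hσ' hxy.2 hxz.2 hyz
  · exact hyz.ne (by rw [hxy.1, hxz.1])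
  · exact hσ' hxy.2 hyz.2 hxz
  · exact hσ' hxz.2 hyz.2 hxy
  · exact hσ' hxy hxz hyz

lemma growthPencilPart_coalescence [Fintype V] [Fintype W] [DecidableEq V] [DecidableEq W]
    (τ : SimpleGraph V) (r : V) (σ : SimpleGraph W) (s : W) [DecidableRel τ.Adj]
    [DecidableRel σ.Adj] [DecidableRel (coalescence τ r σ s).Adj] :
    growthPencilPart (coalescence τ r σ s) =
      glueMatrix Sum.inl (coalescenceInr r s) (growthPencilPart τ) (growthPencilPart σ) := by
  simp only [growthPencilPart, adjMatrix_coalescence, degMatrix_coalescence, glueMatrix,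
    Matrix.mul_sub, Matrix.sub_mul, Matrix.mul_smul, Matrix.smul_mul, smul_add]
  abel

theorem IsRootedIntertwiner.geodesicGrowthSeries_coalescence_eq [Finite V] [Fintype W]
    [DecidableEq W] {σ₁ σ₂ : SimpleGraph W} [DecidableRel σ₁.Adj] [DecidableRel σ₂.Adj] {s : W}
    {κ : ℤ⟦X⟧} {P Q : Matrix W W ℤ⟦X⟧}
    (h : IsRootedIntertwiner s κ (growthPencil σ₁) (growthPencil σ₂) P Q) (hκ : κ ≠ 0)
    (h₁ : σ₁.CliqueFree 3) (h₂ : σ₂.CliqueFree 3) {τ : SimpleGraph V} (hτ : τ.CliqueFree 3)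
    (r : V) : geodesicGrowthSeries (coalescence τ r σ₁ s) =
      geodesicGrowthSeries (coalescence τ r σ₂ s) := by
  classical
  have := Fintype.ofFinite V
  refine geodesicGrowthSeries_eq_of_intertwiner (cliqueFree_three_coalescence hτ h₁ r s)
    (cliqueFree_three_coalescence hτ h₂ r s) hκ
    (P := extendMatrix κ (coalescenceInr r s) P) (Q := extendMatrix κ (coalescenceInr r s) Q) ?_
    (extendMatrix_mulVec_one _ h.mulVec_one) (one_vecMul_extendMatrix _ h.one_vecMul)
  simpa only [growthPencil, growthPencilPart_coalescence] using
    h.extendMatrix_mul_eq (coalescenceInr r s).injective coalescenceInr_eq_inl_iff _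

end CoalescenceGrowth

section Pencil

variable {W R S : Type*} [CommRing R] [CommRing S]

lemma map_adjMatrix (G : SimpleGraph W) [DecidableRel G.Adj] (f : R →+* S) :
    (G.adjMatrix R).map f = G.adjMatrix S := by
  ext a b
  simp [apply_ite f]

variable [Fintype W] [DecidableEq W]

lemma map_degMatrix (G : SimpleGraph W) [DecidableRel G.Adj] (f : R →+* S) :
    (G.degMatrix R).map f = G.degMatrix S := by
  simp [SimpleGraph.degMatrix, Matrix.diagonal_map]

lemma IsRootedIntertwiner.map {s : W} {κ : R} {M₁ M₂ P Q : Matrix W W R}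
    (h : IsRootedIntertwiner s κ M₁ M₂ P Q) (f : R →+* S) :
    IsRootedIntertwiner s (f κ) (M₁.map f) (M₂.map f) (P.map f) (Q.map f) := by
  have hsingle : f ∘ Pi.single s 1 = Pi.single s 1 := by
    ext w
    simp [Pi.single_apply, apply_ite f]
  have hone : f ∘ (1 : W → R) = 1 := by ext; simp
  have hsmul (v : W → R) : f ∘ (κ • v) = f κ • (f ∘ v) := by ext; simp
  refine ⟨?_, ?_, ?_, ?_, ?_⟩
  · rw [← Matrix.map_mul, ← Matrix.map_mul, h.mul_eq]
  · rw [← hsingle, ← hsmul, ← h.mulVec_single]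
    exact funext fun w => (f.map_mulVec P _ w).symm
  · rw [← hsingle, ← hsmul, ← h.single_vecMul]
    exact funext fun w => (f.map_vecMul Q _ w).symm
  · rw [← hone, ← hsmul, ← h.mulVec_one]
    exact funext fun w => (f.map_mulVec P _ w).symm
  · rw [← hone, ← hsmul, ← h.one_vecMul]
    exact funext fun w => (f.map_vecMul Q _ w).symm

lemma IsRootedIntertwiner.smul_add_smul {s : W} {κ κ' : R}
    {M₁ M₂ N₁ N₂ L₁ L₂ P P' Q Q' : Matrix W W R} (h : IsRootedIntertwiner s κ M₁ M₂ P Q)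
    (h' : IsRootedIntertwiner s κ' N₁ N₂ P' Q') (b a : R)
    (hmul : (b • P + a • P') * L₁ = L₂ * (b • Q + a • Q')) :
    IsRootedIntertwiner s (b * κ + a * κ') L₁ L₂ (b • P + a • P') (b • Q + a • Q') where
  mul_eq := hmul
  mulVec_single := by
    rw [add_mulVec, smul_mulVec, smul_mulVec, h.mulVec_single, h'.mulVec_single]
    module
  single_vecMul := by
    rw [vecMul_add, vecMul_smul, vecMul_smul, h.single_vecMul, h'.single_vecMul]
    module
  mulVec_one := by
    rw [add_mulVec, smul_mulVec, smul_mulVec, h.mulVec_one, h'.mulVec_one]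
    module
  one_vecMul := by
    rw [vecMul_add, vecMul_smul, vecMul_smul, h.one_vecMul, h'.one_vecMul]
    module

/-- The hypotheses compare the coefficients of `a² b`, `a b²` and `b³`. -/
lemma pencil_mul_eq_mul_pencil {A₁ A₂ D₁ D₂ P₀ Q₀ Q₁ : Matrix W W R} (a b : R)
    (hlin : P₀ + Q₁ * (1 - D₁) = Q₀ + (1 - D₂) * Q₁)
    (hquad : P₀ * (1 - D₁) + Q₁ * A₁ = (1 - D₂) * Q₀ + A₂ * Q₁) (hcub : P₀ * A₁ = A₂ * Q₀) :
    (b • P₀ + a • Q₁) * ((a * (a + b)) • 1 + (b ^ 2 • A₁ - (b * a) • D₁)) =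
      ((a * (a + b)) • 1 + (b ^ 2 • A₂ - (b * a) • D₂)) * (b • Q₀ + a • Q₁) := by
  simp only [Matrix.mul_add, Matrix.add_mul, Matrix.mul_sub, Matrix.sub_mul, Matrix.mul_one,
    Matrix.one_mul, Matrix.smul_mul, Matrix.mul_smul] at hlin hquad hcub ⊢
  linear_combination (norm := module) (a ^ 2 * b) • hlin + (a * b ^ 2) • hquad + b ^ 3 • hcub

open PowerSeries in
/-- With `a = 1 + X` and `b = X`, the pencil of a graph with degree matrix `D` and adjacency matrix
`A` is `a² + a b (1 - D) + b² A`. This suggests looking for an intertwiner that is linear in `a`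
and `b`. -/
theorem isRootedIntertwiner_growthPencil {σ₁ σ₂ : SimpleGraph W} [DecidableRel σ₁.Adj]
    [DecidableRel σ₂.Adj] {s : W} {κ₀ κ₁ : ℤ} {P₀ Q₀ Q₁ : Matrix W W ℤ}
    (h₀ : IsRootedIntertwiner s κ₀ (σ₁.adjMatrix ℤ) (σ₂.adjMatrix ℤ) P₀ Q₀)
    (h₁ : IsRootedIntertwiner s κ₁ 1 1 Q₁ Q₁)
    (hlin : P₀ + Q₁ * (1 - σ₁.degMatrix ℤ) = Q₀ + (1 - σ₂.degMatrix ℤ) * Q₁)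
    (hquad : P₀ * (1 - σ₁.degMatrix ℤ) + Q₁ * σ₁.adjMatrix ℤ =
      (1 - σ₂.degMatrix ℤ) * Q₀ + σ₂.adjMatrix ℤ * Q₁) :
    IsRootedIntertwiner s (X * (κ₀ : ℤ⟦X⟧) + (1 + X) * (κ₁ : ℤ⟦X⟧))
      (growthPencil σ₁) (growthPencil σ₂)
      ((X : ℤ⟦X⟧) • P₀.map (Int.castRingHom ℤ⟦X⟧) + (1 + X : ℤ⟦X⟧) • Q₁.map (Int.castRingHom ℤ⟦X⟧))
      ((X : ℤ⟦X⟧) • Q₀.map (Int.castRingHom ℤ⟦X⟧) +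
        (1 + X : ℤ⟦X⟧) • Q₁.map (Int.castRingHom ℤ⟦X⟧)) := by
  have hcub := (h₀.map (Int.castRingHom ℤ⟦X⟧)).mul_eq
  replace hlin := congrArg (Int.castRingHom ℤ⟦X⟧).mapMatrix hlin
  replace hquad := congrArg (Int.castRingHom ℤ⟦X⟧).mapMatrix hquad
  simp only [map_add, map_sub, map_mul, map_one, RingHom.mapMatrix_apply, map_adjMatrix,
    map_degMatrix] at hlin hquad hcub
  have hX : 1 + 2 * X = (1 + X + X : ℤ⟦X⟧) := by ring
  have hmul := pencil_mul_eq_mul_pencil (1 + X) X hlin hquad hcub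
  rw [← hX] at hmul
  exact (h₀.map _).smul_add_smul (h₁.map _) _ _ hmul

end Pencil

/-! ### Coalescences of trees -/

section Trees

lemma connected_of_forall_exists_adj_lt {V : Type*} [Preorder V] [WellFoundedLT V]
    {G : SimpleGraph V} {r : V} (h : ∀ v, v ≠ r → ∃ w < v, G.Adj v w) : G.Connected := by
  have hreach (v : V) : G.Reachable v r := by
    induction v using WellFoundedLT.induction with
    | ind v ih =>
      by_cases hv : v = r
      · exact hv ▸ .refl v
      · obtain ⟨w, hlt, hadj⟩ := h v hv
        exact hadj.reachable.trans (ih w hlt)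
  have : Nonempty V := ⟨r⟩
  exact ⟨fun v w => (hreach v).trans (hreach w).symm⟩

variable {V W : Type*} {τ : SimpleGraph V} {σ : SimpleGraph W}

lemma connected_coalescence (hτ : τ.Connected) (hσ : σ.Connected) (r : V) (s : W) :
    (coalescence τ r σ s).Connected := by
  have hroot (x) : (τ.map Function.Embedding.inl ⊔ σ.map (coalescenceInr r s)).Reachable
      x (.inl r) := by
    rcases x with a | w
    · exact ((hτ.preconnected a r).map (SimpleGraph.Embedding.map _ τ).toHom).mono le_sup_left
    · have h := ((hσ.preconnected w s).map
        (SimpleGraph.Embedding.map (coalescenceInr r s) σ).toHom).mono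
          (le_sup_right (a := τ.map Function.Embedding.inl))
      simpa using h
  have : Nonempty (V ⊕ {w : W // w ≠ s}) := ⟨.inl r⟩
  rw [coalescence_eq_sup]
  exact ⟨fun x y => (hroot x).trans (hroot y).symm⟩

variable [Finite V] [Finite W]

lemma card_edgeSet_coalescence (τ : SimpleGraph V) (r : V) (σ : SimpleGraph W) (s : W) :
    Nat.card (coalescence τ r σ s).edgeSet = Nat.card τ.edgeSet + Nat.card σ.edgeSet := by
  have hdisj := SimpleGraph.disjoint_edgeSet.2 (disjoint_map_inl_map_coalescenceInr τ r σ s)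
  rw [coalescence_eq_sup]
  simp only [Nat.card_coe_set_eq]
  rw [SimpleGraph.edgeSet_sup, Set.ncard_union_eq hdisj, SimpleGraph.edgeSet_map,
    SimpleGraph.edgeSet_map, Set.ncard_image_of_injective _ (Function.Embedding.injective _),
    Set.ncard_image_of_injective _ (Function.Embedding.injective _)]

theorem isTree_coalescence (hτ : τ.IsTree) (hσ : σ.IsTree) (r : V) (s : W) :
    (coalescence τ r σ s).IsTree := by
  rw [SimpleGraph.isTree_iff_connected_and_card] at hτ hσ ⊢
  refine ⟨connected_coalescence hτ.1 hσ.1 r s, ?_⟩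
  have hW : Nat.card {w : W // w ≠ s} + 1 = Nat.card W := by
    rw [← Finite.card_option]
    classical exact Nat.card_congr (Equiv.optionSubtypeNe s)
  rw [card_edgeSet_coalescence, Nat.card_sum]
  omega

end Trees

/-! ### Forks -/

section Fork

variable {V W : Type*}

/-- A vertex `v` is a fork if all its neighbours have degree `2` and one of them is adjacent to a
leaf other than `v`. The number of forks distinguishes the graphs of the two families. -/
def IsFork (G : SimpleGraph V) [G.LocallyFinite] (v : V) : Prop :=
  (∀ x, G.Adj v x → G.degree x = 2) ∧ ∃ x y, G.Adj v x ∧ G.Adj x y ∧ y ≠ v ∧ G.degree y = 1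

lemma IsFork.map_iso {G : SimpleGraph V} {H : SimpleGraph W} [G.LocallyFinite] [H.LocallyFinite]
    (φ : G ≃g H) {v : V} (h : IsFork G v) : IsFork H (φ v) := by
  obtain ⟨hdeg, x, y, hx, hy, hne, hleaf⟩ := h
  refine ⟨fun z hz => ?_, φ x, φ y, φ.map_adj_iff.2 hx, φ.map_adj_iff.2 hy, φ.injective.ne hne,
    (φ.degree_eq y).trans hleaf⟩
  obtain ⟨z, rfl⟩ := φ.surjective z
  exact (φ.degree_eq z).trans (hdeg z (φ.map_adj_iff.1 hz))

lemma ncard_isFork_le_of_iso [Finite V] {G : SimpleGraph V} {H : SimpleGraph W} [G.LocallyFinite]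
    [H.LocallyFinite] (φ : G ≃g H) : {v | IsFork H v}.ncard ≤ {v | IsFork G v}.ncard :=
  Set.ncard_le_ncard_of_injOn φ.symm (fun _ hv => hv.map_iso φ.symm) φ.symm.injective.injOn
    (Set.toFinite _)

section Degree

lemma ncard_neighborSet_eq_degree (G : SimpleGraph V) [G.LocallyFinite] (v : V) :
    (G.neighborSet v).ncard = G.degree v := by
  rw [← Nat.card_coe_set_eq, Nat.card_eq_fintype_card, SimpleGraph.card_neighborSet_eq_degree]

lemma neighborSet_map_apply (G : SimpleGraph V) (f : V ↪ W) (v : V) :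
    (G.map f).neighborSet (f v) = f '' G.neighborSet v := by
  ext w
  simp

lemma neighborSet_map_of_notMem_range (G : SimpleGraph V) {f : V ↪ W} {w : W}
    (hw : w ∉ Set.range f) : (G.map f).neighborSet w = ∅ := by
  ext x
  simp only [SimpleGraph.mem_neighborSet, SimpleGraph.map_adj, Set.mem_empty_iff_false, iff_false]
  rintro ⟨a, b, -, rfl, -⟩
  exact hw ⟨a, rfl⟩

lemma neighborSet_coalescence (τ : SimpleGraph V) (r : V) (σ : SimpleGraph W) (s : W)
    (x : V ⊕ {w : W // w ≠ s}) : (coalescence τ r σ s).neighborSet x =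
      (τ.map Function.Embedding.inl).neighborSet x ∪
        (σ.map (coalescenceInr r s)).neighborSet x := by
  rw [coalescence_eq_sup]
  rfl

variable {τ : SimpleGraph V} {r : V} {σ : SimpleGraph W} {s : W}
  [(coalescence τ r σ s).LocallyFinite]

lemma degree_coalescence_inr [σ.LocallyFinite] (w : {w : W // w ≠ s}) :
    (coalescence τ r σ s).degree (.inr w) = σ.degree w := by
  rw [← ncard_neighborSet_eq_degree, neighborSet_coalescence,
    neighborSet_map_of_notMem_range _ (by simp), Set.empty_union, ← coalescenceInr_coe r w,
    neighborSet_map_apply, Set.ncard_image_of_injective _ (coalescenceInr r s).injective,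
    ncard_neighborSet_eq_degree]

lemma degree_coalescence_inl_of_ne [τ.LocallyFinite] {a : V} (ha : a ≠ r) :
    (coalescence τ r σ s).degree (.inl a) = τ.degree a := by
  rw [← ncard_neighborSet_eq_degree, neighborSet_coalescence, neighborSet_map_of_notMem_range σ
    (by simp [coalescenceInr_eq_inl_iff, ha]), Set.union_empty, ← Function.Embedding.inl_apply,
    neighborSet_map_apply, Set.ncard_image_of_injective _ (Function.Embedding.injective _),
    ncard_neighborSet_eq_degree]

lemma degree_coalescence_root [τ.LocallyFinite] [σ.LocallyFinite] :
    (coalescence τ r σ s).degree (.inl r) = τ.degree r + σ.degree s := by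
  have hτ := neighborSet_map_apply τ (Function.Embedding.inl (β := {w : W // w ≠ s})) r
  have hσ := neighborSet_map_apply σ (coalescenceInr r s) s
  have hdisj : Disjoint (Function.Embedding.inl '' τ.neighborSet r)
      (coalescenceInr r s '' σ.neighborSet s) := by
    rw [← hτ, ← hσ, coalescenceInr_root, Set.disjoint_left]
    exact fun x => SimpleGraph.disjoint_left.1 (disjoint_map_inl_map_coalescenceInr τ r σ s) _ x
  rw [coalescenceInr_root] at hσ
  rw [← ncard_neighborSet_eq_degree, neighborSet_coalescence, hσ]
  rw [Function.Embedding.inl_apply] at hτ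
  rw [hτ, Set.ncard_union_eq hdisj ((Set.toFinite _).image _) ((Set.toFinite _).image _),
    Set.ncard_image_of_injective _ (Function.Embedding.injective _),
    Set.ncard_image_of_injective _ (coalescenceInr r s).injective,
    ncard_neighborSet_eq_degree, ncard_neighborSet_eq_degree]

end Degree

section Coalescence

variable {τ : SimpleGraph V} {r : V} {σ : SimpleGraph W} {s : W} [σ.LocallyFinite]
  [(coalescence τ r σ s).LocallyFinite]

lemma IsFork.coalescence_inr {w : {w : W // w ≠ s}} (hs : 1 < σ.degree s) (hsw : ¬ σ.Adj s w)
    (h : IsFork σ w) : IsFork (coalescence τ r σ s) (.inr w) := by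
  obtain ⟨hdeg, x, y, hx, hy, hne, hleaf⟩ := h
  have hxs : x ≠ s := fun he => hsw (he ▸ hx.symm)
  have hys : y ≠ s := by
    rintro rfl
    omega
  refine ⟨?_, .inr ⟨x, hxs⟩, .inr ⟨y, hys⟩, hx, hy, fun he => hne ?_, ?_⟩
  · rintro (a | z) hz
    · exact absurd hz.2 hsw
    · rw [degree_coalescence_inr]
      exact hdeg z hz
  · exact congrArg Subtype.val (Sum.inr.inj he)
  · rwa [degree_coalescence_inr]

lemma IsFork.ne_root_of_coalescence_inl {a : V} {w : W} (hsw : σ.Adj s w) (hdeg : σ.degree w ≠ 2)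
    (h : IsFork (coalescence τ r σ s) (.inl a)) : a ≠ r := by
  rintro rfl
  have hw := h.1 (.inr ⟨w, hsw.ne'⟩) ⟨rfl, hsw⟩
  rw [degree_coalescence_inr] at hw
  exact hdeg hw

variable [τ.LocallyFinite]

lemma two_lt_degree_coalescence_root (hr : 0 < τ.degree r) (hs : 1 < σ.degree s) :
    2 < (coalescence τ r σ s).degree (.inl r) := by
  rw [degree_coalescence_root]
  omega

lemma IsFork.not_adj_of_coalescence_inr {w : {w : W // w ≠ s}} (hr : 0 < τ.degree r)
    (hs : 1 < σ.degree s) (h : IsFork (coalescence τ r σ s) (.inr w)) : ¬ σ.Adj s w := fun hsw =>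
  (two_lt_degree_coalescence_root hr hs).ne' (h.1 (.inl r) ⟨rfl, hsw⟩)

lemma IsFork.of_coalescence_inr {w : {w : W // w ≠ s}} (hr : 0 < τ.degree r)
    (hs : 1 < σ.degree s) (h : IsFork (coalescence τ r σ s) (.inr w)) : IsFork σ w := by
  have hsw := h.not_adj_of_coalescence_inr hr hs
  have hroot := two_lt_degree_coalescence_root (τ := τ) hr hs
  obtain ⟨hdeg, x, y, hx, hy, hne, hleaf⟩ := h
  refine ⟨fun z hz => ?_, ?_⟩
  · have hzs : z ≠ s := fun he => hsw (he ▸ hz.symm)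
    exact (degree_coalescence_inr ⟨z, hzs⟩).symm.trans (hdeg (.inr ⟨z, hzs⟩) hz)
  · rcases x with a | x
    · exact absurd hx.2 hsw
    · rcases y with a | y
      · obtain ⟨rfl, -⟩ := hy
        omega
      · rw [degree_coalescence_inr] at hleaf
        exact ⟨x, y, hx, hy, fun he => hne (congrArg Sum.inr (Subtype.ext he)), hleaf⟩

lemma IsFork.coalescence_inl_congr {W' : Type*} {σ' : SimpleGraph W'} {s' : W'} [σ'.LocallyFinite]
    [(coalescence τ r σ' s').LocallyFinite] (hr : 0 < τ.degree r) (hs : 1 < σ.degree s)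
    (hss' : σ.degree s = σ'.degree s') {a : V} (ha : a ≠ r)
    (h : IsFork (coalescence τ r σ s) (.inl a)) : IsFork (coalescence τ r σ' s') (.inl a) := by
  have hroot := two_lt_degree_coalescence_root (τ := τ) hr hs
  have hdegree (b : V) : (coalescence τ r σ' s').degree (.inl b) =
      (coalescence τ r σ s).degree (.inl b) := by
    by_cases hb : b = r
    · rw [hb, degree_coalescence_root, degree_coalescence_root, hss']
    · rw [degree_coalescence_inl_of_ne hb, degree_coalescence_inl_of_ne hb]
  obtain ⟨hdeg, x, y, hx, hy, hne, hleaf⟩ := h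
  rcases x with b | w
  · rcases y with c | w
    · refine ⟨?_, .inl b, .inl c, hx, hy, by simpa using hne, by rwa [hdegree]⟩
      rintro (d | w) hz
      · rw [hdegree]
        exact hdeg (.inl d) hz
      · exact absurd hz.1 ha
    · obtain ⟨rfl, -⟩ := hy
      exact absurd (hdeg _ hx) hroot.ne'
  · exact absurd hx.1 ha

theorem isEmpty_iso_coalescence [Finite V] [Finite W] {σ' : SimpleGraph W} [σ'.LocallyFinite]
    [(coalescence τ r σ' s).LocallyFinite] (hr : 0 < τ.degree r) (hs : 1 < σ.degree s)
    (hss' : σ.degree s = σ'.degree s) (hroot : ∃ w, σ.Adj s w ∧ σ.degree w ≠ 2)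
    (hσ : ∀ w, ¬ σ.Adj s w → ¬ IsFork σ w) (hσ' : ∃ w, w ≠ s ∧ ¬ σ'.Adj s w ∧ IsFork σ' w) :
    IsEmpty (coalescence τ r σ s ≃g coalescence τ r σ' s) := by
  refine ⟨fun φ => ?_⟩
  have hinr (w) : ¬ IsFork (coalescence τ r σ s) (.inr w) := fun h =>
    hσ w (h.not_adj_of_coalescence_inr hr hs) (h.of_coalescence_inr hr hs)
  obtain ⟨w, hws, hsw, hw⟩ := hσ'
  have hlt : {v | IsFork (coalescence τ r σ s) v} ⊂ {v | IsFork (coalescence τ r σ' s) v} := by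
    refine (Set.ssubset_iff_of_subset ?_).2
      ⟨.inr ⟨w, hws⟩, hw.coalescence_inr (hss' ▸ hs) hsw, hinr _⟩
    rintro (a | w) h
    · obtain ⟨w, hsw, hdeg⟩ := hroot
      exact h.coalescence_inl_congr hr hs hss' (h.ne_root_of_coalescence_inl hsw hdeg)
    · exact absurd h (hinr w)
  exact (Set.ncard_lt_ncard hlt (Set.toFinite _)).not_ge (ncard_isFork_le_of_iso φ)

end Coalescence

end Fork

/-! ### McKay's trees -/

section McKay

instance decidableRelMckayT1Adj : DecidableRel mckayT1.Adj := by
  unfold mckayT1; infer_instance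

instance decidableRelMckayT2Adj : DecidableRel mckayT2.Adj := by
  unfold mckayT2; infer_instance

lemma isTree_mckayT1 : mckayT1.IsTree := by
  rw [SimpleGraph.isTree_iff_connected_and_card, Nat.card_eq_fintype_card,
    Nat.card_eq_fintype_card]
  exact ⟨connected_of_forall_exists_adj_lt (r := 0) (by decide +kernel), by decide +kernel⟩

lemma isTree_mckayT2 : mckayT2.IsTree := by
  rw [SimpleGraph.isTree_iff_connected_and_card, Nat.card_eq_fintype_card,
    Nat.card_eq_fintype_card]
  exact ⟨connected_of_forall_exists_adj_lt (r := 0) (by decide +kernel), by decide +kernel⟩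

/-- An intertwiner of the adjacency matrices of McKay's trees, found by solving the linear
conditions of `IsRootedIntertwiner`. -/
def mckaySpectralIntertwiner : Matrix (Fin 16) (Fin 16) ℤ :=
  !![22, 0, 0, 0, 0, 0, 0, 0, 0, 0, 0, 0, 0, 0, 0, 0;
    0, 14, 8, 2, 2, -4, -4, -4, -6, 0, -4, 4, 8, -2, 4, 4;
    0, 8, 14, -2, -2, 4, 4, 4, 6, 0, 4, -4, -8, 2, -4, -4;
    0, 4, -4, 10, 10, 2, 2, 2, -8, 0, 2, -2, -4, 12, -2, -2;
    0, 1, -1, 8, 8, 6, -5, -5, 9, 0, 6, -6, -1, -8, 5, 5;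
    0, -5, 5, 4, 4, 14, 3, 3, -1, 0, -8, 8, 5, -4, -3, -3;
    0, 3, -3, 2, 2, -4, 7, 7, 5, 0, -4, 4, -3, -2, 15, -7;
    0, 3, -3, 2, 2, -4, 7, 7, 5, 0, -4, 4, -3, -2, -7, 15;
    0, 8, -8, -2, -2, 4, 4, 4, 6, 0, 4, -4, 14, 2, -4, -4;
    0, 0, 0, 0, 0, 0, 0, 0, 0, 22, 0, 0, 0, 0, 0, 0;
    0, -5, 5, 4, 4, -8, 3, 3, -1, 0, 14, 8, 5, -4, -3, -3;
    0, 5, -5, -4, -4, 8, -3, -3, 1, 0, 8, 14, -5, 4, 3, 3;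
    0, -4, 4, 1, 1, -2, -13, 9, 8, 0, -2, 2, 4, 10, 2, 2;
    0, -4, 4, 1, 1, -2, 9, -13, 8, 0, -2, 2, 4, 10, 2, 2;
    0, -3, 3, -13, 9, 4, 4, 4, -5, 0, 4, -4, 3, 2, 7, 7;
    0, -3, 3, 9, -13, 4, 4, 4, -5, 0, 4, -4, 3, 2, 7, 7]

lemma mckaySpectralIntertwiner_mul_transpose :
    mckaySpectralIntertwiner * mckaySpectralIntertwinerᵀ = (484 : ℤ) • 1 := by
  decide +kernel

lemma det_mckaySpectralIntertwiner_ne_zero : mckaySpectralIntertwiner.det ≠ 0 := by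
  have h := congrArg det mckaySpectralIntertwiner_mul_transpose
  rw [det_mul, det_smul, det_one] at h
  exact left_ne_zero_of_mul (h.trans_ne (by norm_num))

lemma isRootedIntertwiner_mckaySpectralIntertwiner :
    IsRootedIntertwiner 0 22 (mckayT1.adjMatrix ℤ) (mckayT2.adjMatrix ℤ)
      mckaySpectralIntertwiner mckaySpectralIntertwiner where
  mul_eq := by decide +kernel
  mulVec_single := by decide +kernel
  single_vecMul := by decide +kernel
  mulVec_one := by decide +kernel
  one_vecMul := by decide +kernel

/-- The matrix `Q₀` of `isRootedIntertwiner_growthPencil` for McKay's trees, found together with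
`mckayGrowthQ₁` by solving the linear conditions of that theorem. -/
def mckayGrowthQ₀ : Matrix (Fin 16) (Fin 16) ℤ :=
  !![26, 0, 0, 0, 0, 0, 0, 0, 0, 0, 0, 0, 0, 0, 0, 0;
    0, 22, 10, 3, 3, -6, -2, -2, -10, 0, -4, 2, 6, 0, 2, 2;
    0, 4, 16, -3, -3, 6, 2, 2, 10, 0, 4, -2, -6, 0, -2, -2;
    0, 6, -2, 13, 13, 0, 3, 3, -6, 0, 1, -3, -4, 8, -3, -3;
    0, 7, -2, 6, 6, 14, -3, -3, 10, 0, 4, -10, -1, -8, 3, 3;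
    0, -7, 8, 2, 2, 22, 3, 3, -2, 0, -6, 10, 3, -6, -3, -3;
    0, 7, -5, 2, 2, -4, 10, 10, 6, 0, -8, 3, -2, -1, 3, 3;
    0, 7, -5, 2, 2, -4, 10, 10, 6, 0, -8, 3, -2, -1, 3, 3;
    0, 8, -6, -1, -1, 2, 4, 4, 4, 0, 12, -4, 10, 2, -4, -4;
    0, 0, 0, 0, 0, 0, 0, 0, 0, 26, 0, 0, 0, 0, 0, 0;
    0, -9, 6, 8, 8, -16, 2, 2, 6, 0, 11, 11, 13, -12, -2, -2;
    0, 7, -8, -2, -2, 4, -3, -3, 2, 0, 6, 16, -3, 6, 3, 3;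
    0, -6, 2, 0, 0, 0, -3, -3, 6, 0, -1, 3, 4, 18, 3, 3;
    0, -6, 2, 0, 0, 0, -3, -3, 6, 0, -1, 3, 4, 18, 3, 3;
    0, -7, 5, -2, -2, 4, 3, 3, -6, 0, 8, -3, 2, 1, 10, 10;
    0, -7, 5, -2, -2, 4, 3, 3, -6, 0, 8, -3, 2, 1, 10, 10]

/-- The matrix `Q₁` of `isRootedIntertwiner_growthPencil` for McKay's trees. -/
def mckayGrowthQ₁ : Matrix (Fin 16) (Fin 16) ℤ :=
  !![-5, 0, 0, 0, 0, 0, 0, 0, 0, 0, 0, 0, 0, 0, 0, 0;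
    0, -6, 1, 3, 3, 4, 1, 1, 4, 0, -2, -4, -5, -3, -1, -1;
    0, 1, -6, -3, -3, -4, -1, -1, -4, 0, 2, 4, 5, 3, 1, 1;
    0, -4, 4, -5, -5, 3, 1, 1, 2, 0, -1, -3, 4, 0, -1, -1;
    0, -5, 5, -2, -2, -4, 3, 3, -1, 0, 5, 4, -7, 2, -3, -3;
    0, -1, 1, -4, -4, -6, -2, -2, 5, 0, 2, 1, -3, 4, 2, 2;
    0, -2, 2, 1, 1, 1, 0, 0, -3, 0, 4, -1, -2, -1, -3, -2;
    0, -2, 2, 1, 1, 1, 0, 0, -3, 0, 4, -1, -2, -1, -2, -3;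
    0, -2, 2, 1, 1, 2, -4, -4, 5, 0, -10, -2, -1, -1, 4, 4;
    0, 0, 0, 0, 0, 0, 0, 0, 0, -5, 0, 0, 0, 0, 0, 0;
    0, 3, -3, -4, -4, 5, 2, 2, -7, 0, -1, -5, 7, 4, -2, -2;
    0, 1, -1, 4, 4, 1, 2, 2, -5, 0, -2, -6, 3, -4, -2, -2;
    0, 4, -4, 2, 3, -3, -1, -1, -2, 0, 1, 3, -4, -5, 1, 1;
    0, 4, -4, 3, 2, -3, -1, -1, -2, 0, 1, 3, -4, -5, 1, 1;
    0, 2, -2, -1, -1, -1, -3, -2, 3, 0, -4, 1, 2, 1, 0, 0;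
    0, 2, -2, -1, -1, -1, -2, -3, 3, 0, -4, 1, 2, 1, 0, 0]

/-- The matrix `P₀` of `isRootedIntertwiner_growthPencil` for McKay's trees, which is determined by
the linear coefficient there. -/
def mckayGrowthP₀ : Matrix (Fin 16) (Fin 16) ℤ :=
  mckayGrowthQ₀ + (1 - mckayT2.degMatrix ℤ) * mckayGrowthQ₁ -
    mckayGrowthQ₁ * (1 - mckayT1.degMatrix ℤ)

lemma isRootedIntertwiner_mckayGrowthP₀ :
    IsRootedIntertwiner 0 26 (mckayT1.adjMatrix ℤ) (mckayT2.adjMatrix ℤ)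
      mckayGrowthP₀ mckayGrowthQ₀ where
  mul_eq := by decide +kernel
  mulVec_single := by decide +kernel
  single_vecMul := by decide +kernel
  mulVec_one := by decide +kernel
  one_vecMul := by decide +kernel

lemma isRootedIntertwiner_mckayGrowthQ₁ :
    IsRootedIntertwiner 0 (-5) 1 1 mckayGrowthQ₁ mckayGrowthQ₁ where
  mul_eq := (mul_one _).trans (one_mul _).symm
  mulVec_single := by decide +kernel
  single_vecMul := by decide +kernel
  mulVec_one := by decide +kernel
  one_vecMul := by decide +kernel

lemma mckayGrowth_quadratic_coeff :
    mckayGrowthP₀ * (1 - mckayT1.degMatrix ℤ) + mckayGrowthQ₁ * mckayT1.adjMatrix ℤ =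
      (1 - mckayT2.degMatrix ℤ) * mckayGrowthQ₀ + mckayT2.adjMatrix ℤ * mckayGrowthQ₁ := by
  decide +kernel

open PowerSeries in
theorem geodesicGrowthSeries_familyOne_eq_familyTwo {V : Type*} [Finite V] {τ : SimpleGraph V}
    (hτ : τ.CliqueFree 3) (r : V) :
    geodesicGrowthSeries (familyOne τ r) = geodesicGrowthSeries (familyTwo τ r) := by
  classical
  have h := isRootedIntertwiner_growthPencil isRootedIntertwiner_mckayGrowthP₀
    isRootedIntertwiner_mckayGrowthQ₁ (sub_add_cancel _ _) mckayGrowth_quadratic_coeff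
  refine h.geodesicGrowthSeries_coalescence_eq (fun h0 => ?_)
    (isTree_mckayT1.isAcyclic.cliqueFree le_rfl) (isTree_mckayT2.isAcyclic.cliqueFree le_rfl) hτ r
  simpa [map_ofNat] using congrArg (constantCoeff (R := ℤ)) h0

lemma not_isFork_mckayT1_of_not_adj : ∀ w, ¬ mckayT1.Adj 0 w → ¬ IsFork mckayT1 w := by
  unfold IsFork
  decide +kernel

lemma isFork_mckayT2_eleven : IsFork mckayT2 11 := by
  unfold IsFork
  decide +kernel

theorem isEmpty_familyOne_iso_familyTwo {V : Type*} [Finite V] {τ : SimpleGraph V} {r : V}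
    (hr : ¬ τ.IsIsolated r) : IsEmpty (familyOne τ r ≃g familyTwo τ r) := by
  classical
  have := Fintype.ofFinite V
  have hdeg : 1 < mckayT1.degree 0 := by decide +kernel
  have hdeg' : mckayT1.degree 0 = mckayT2.degree 0 := by decide +kernel
  have hroot : mckayT1.Adj 0 1 ∧ mckayT1.degree 1 ≠ 2 := by decide +kernel
  exact isEmpty_iso_coalescence ((τ.degree_pos r).2 hr) hdeg hdeg' ⟨1, hroot⟩
    not_isFork_mckayT1_of_not_adj ⟨11, by decide, by decide +kernel, isFork_mckayT2_eleven⟩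

end McKay

end GeodesicGrowth

end

open GeodesicGrowth in
theorem theorem1_general {V : Type*} [Fintype V] {τ : SimpleGraph V} {r : V}
    (hτ : τ.CliqueFree 3) (hr : ¬ τ.IsIsolated r) :
    Fintype.card (V ⊕ {w : Fin 16 // w ≠ 0}) = Fintype.card V + 15 ∧
    (τ.IsTree → (familyOne τ r).IsTree ∧ (familyTwo τ r).IsTree) ∧
    ¬ Nonempty (familyOne τ r ≃g familyTwo τ r) ∧
    Cospectral (familyOne τ r) (familyTwo τ r) ∧
    Cospectral (familyOne τ r)ᶜ (familyTwo τ r)ᶜ ∧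
    geodesicGrowthSeries (familyOne τ r) = geodesicGrowthSeries (familyTwo τ r) := by
  obtain ⟨hspec, hcompl⟩ := isRootedIntertwiner_mckaySpectralIntertwiner.cospectral_coalescence
    (by norm_num) det_mckaySpectralIntertwiner_ne_zero τ r
  exact ⟨by simp, fun h => ⟨isTree_coalescence h isTree_mckayT1 r 0,
      isTree_coalescence h isTree_mckayT2 r 0⟩,
    not_nonempty_iff.2 (isEmpty_familyOne_iso_familyTwo hr), hspec, hcompl,
    geodesicGrowthSeries_familyOne_eq_familyTwo hτ r⟩

/-- For every `n ≥ 17` the two families `τ · T₁` and `τ · T₂` are indexed by the rooted trees `(τ, r)`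
on `n - 15` vertices; the first conjunct says that there are such. -/
theorem theorem1 (n : ℕ) (hn : 17 ≤ n) :
    (∃ τ : SimpleGraph (Fin (n - 15)), τ.IsTree) ∧
    ∀ (V : Type*) [Fintype V] (τ : SimpleGraph V) (r : V),
      τ.IsTree → Fintype.card V + 15 = n →
      Fintype.card (V ⊕ {w : Fin 16 // w ≠ 0}) = n ∧
      (GeodesicGrowth.familyOne τ r).IsTree ∧
      (GeodesicGrowth.familyTwo τ r).IsTree ∧
      ¬ Nonempty (GeodesicGrowth.familyOne τ r ≃g GeodesicGrowth.familyTwo τ r) ∧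
      GeodesicGrowth.Cospectral (GeodesicGrowth.familyOne τ r) (GeodesicGrowth.familyTwo τ r) ∧
      GeodesicGrowth.Cospectral (GeodesicGrowth.familyOne τ r)ᶜ (GeodesicGrowth.familyTwo τ r)ᶜ ∧
      GeodesicGrowth.geodesicGrowthSeries (GeodesicGrowth.familyOne τ r) =
        GeodesicGrowth.geodesicGrowthSeries (GeodesicGrowth.familyTwo τ r) := by
  refine ⟨?_, fun V _ τ r hτ hcard => ?_⟩
  · have : Nonempty (Fin (n - 15)) := ⟨⟨0, by omega⟩⟩
    obtain ⟨T, -, hT⟩ := (SimpleGraph.connected_top (V := Fin (n - 15))).exists_isTree_le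
    exact ⟨T, hT⟩
  · have : Nontrivial V := Fintype.one_lt_card_iff_nontrivial.1 (by omega)
    obtain ⟨hV, htree, h⟩ := theorem1_general (hτ.isAcyclic.cliqueFree le_rfl)
      (hτ.connected.preconnected.not_isIsolated r)
    exact ⟨hV.trans hcard, (htree hτ).1, (htree hτ).2, h⟩
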